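/- Let $\mathfrak g$ be of type $B_\ell$ or $C_\ell$ ($\ell\ge 2$), $F_4$ or $G_2$, with rank set $I=\{1,\dots,\ell\}$, simple roots $\alpha_i$, Cartan matrix $C_{ij}=2(\alpha_i,\alpha_j)/(\alpha_i,\alpha_i)$, and $d_i=\tfrac12(\alpha_i,\alpha_i)$, $d=\min_i d_i$, $d'=\max_i d_i$, normalized as follows. $B_\ell$: $d_i=1$ for $i<\ell$, $d_\ell=\frac12$. $C_\ell$: $d_i=1$ for $i<\ell$, $d_\ell=2$. $F_4$: $d_1=d_2=1$, $d_3=d_4=\frac12$. $G_2$: $d_1=1$, $d_2=3$. (The Dynkin diagram is the path $1-2-\cdots-\ell$.) Fix an integer $m>1$ and let $\mathcal Y_m=\mathbb C(y_i(n);\ i\in I,\ n\in d\mathbb Z/d'm\mathbb Z)$ be the rational function field in the independent variables $y_i(n)$; put $y_0(n)=y_{\ell+1}(n)=1$. For $i\in I$ and $n\in d\mathbb Z/d'm\mathbb Z$ define $$F_i(n)=\begin{cases} y_{i-1}(n+\frac12)\,y_{i+1}(n) & (\mathfrak g,i)=(B_\ell,\ell),(F_4,3),\\ y_{i-1}(n+1)\,y_{i+1}(n)\,y_{i+1}(n+\frac12)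 & (\mathfrak g,i)=(B_\ell,\ell-1),(F_4,2),\\ y_{\ell-1}(n+1)\,y_{\ell-1}(n+2) & (\mathfrak g,i)=(C_\ell,\ell),\\ y_1(n+1)\,y_1(n+2)\,y_1(n+3) & (\mathfrak g,i)=(G_2,2),\\ \prod_{j<i,\,C_{ij}\ne0}y_j(n+d_j)\prod_{j>i,\,C_{ij}\neq 0}y_j(n) & \text{otherwise,}\end{cases}$$ $$X_i(n)=\frac{F_i(n)}{y_i(n)\,y_i(n+d_i)},\qquad P_i(n)=1+\sum_{k=0}^{d'm/d_i-2}X_i(n)X_i(n-d_i)\cdots X_i(n-d_ik),\qquad z_i(n)=y_i(n)+\frac{F_i(n)}{y_i(n+d_i)}.$$ For $1\le s\le d_i/d$ let $N_{i,s}=(d_i\mathbb Z+(s-1)d)/d'm\mathbb Z\subset d\mathbb Z/d'm\mathbb Z$ and $$\boldsymbol y_{i,s}=\prod_{n\in N_{i,s}}y_i(n),\qquad \boldsymbol F_{i,s}=\prod_{n\in N_{i,s}}F_i(n),\qquad \delta_{i,s}=\boldsymbol y_{i,s}-\frac{\boldsymbol F_{i,s}}{\boldsymbol y_{i,s}}.$$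 Let $\mathcal Z_m^{(i)}=\mathbb C(z_i(n),\,y_j(n);\ j\in I\setminus\{i\},\ n\in d\mathbb Z/d'm\mathbb Z)\subset\mathcal Y_m$ and $$\mathcal Z_m^{(i)\prime}=\begin{cases}\mathcal Z_m^{(i)} & \text{if } d_i=d,\\ \mathcal Z_m^{(i)}(\delta_{i,1}\delta_{i,2}) & \text{if } d_i=2d,\\ \mathcal Z_m^{(i)}(\delta_{i,1}\delta_{i,2},\,\delta_{i,2}\delta_{i,3}) & \text{if } d_i=3d.\end{cases}$$ Then for every $i\in I$ there is a unique $\mathbb C$-algebra automorphism $r_i$ of $\mathcal Y_m$ such that $$r_i(y_i(n))=\frac{P_i(n-2d_i)}{P_i(n-d_i)}\,y_i(n)\,X_i(n-d_i),\qquad r_i(y_j(n))=y_j(n)\quad(j\ne i)$$ for all $n\in d\mathbb Z/d'm\mathbb Z$ (this is the action on $\mathcal Y_m$ of the simple reflection $r_i$ of the Weyl group), and its invariant subfield is $$\mathcal Y_m^{r_i}=\mathcal Z_m^{(i)\prime}.$$ -/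

import Mathlib

open scoped BigOperators

noncomputable section

namespace WeylInv

/-- The non-simply-laced types `B_ℓ` and `C_ℓ` (with `ℓ ≥ 2`), `F₄`, `G₂`. -/
inductive NSLType : Type
  | B (l : ℕ) (hl : 2 ≤ l)
  | C (l : ℕ) (hl : 2 ≤ l)
  | F4
  | G2

/-- The rank `ℓ`. The rank set `I = {1, …, ℓ}` is modelled by `Fin ℓ`:
the label of `i : Fin ℓ` is `i + 1`. -/
def NSLType.rank : NSLType → ℕ
  | .B l _ => l
  | .C l _ => l
  | .F4 => 4
  | .G2 => 2

/-- The Cartan matrix `C_{ij} = 2 (α_i, α_j) / (α_i, α_i)`. Here `α_ℓ` is the short simple root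
in type `B_ℓ` and the long one in type `C_ℓ`; `α₁, α₂` are long in type `F₄`;
`α₂` is long in type `G₂`. (Mathlib's matrices of types B, C, F use the transposed convention.) -/
def cartan : (g : NSLType) → Matrix (Fin g.rank) (Fin g.rank) ℤ
  | .B l _ => (CartanMatrix.B l).transpose
  | .C l _ => (CartanMatrix.C l).transpose
  | .F4 => CartanMatrix.F₄.transpose
  | .G2 => CartanMatrix.G₂

/-- The ratio `d' / d`, where `d_i = (α_i, α_i) / 2`, `d = min d_i` and `d' = max d_i`. -/
def ratio : NSLType → ℕ
  | .B _ _ => 2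
  | .C _ _ => 2
  | .F4 => 2
  | .G2 => 3

/-- The integer `d_i / d`. From now on all lengths are measured in units of `d`:

* `B_ℓ`: `d_i = 1` for `i < ℓ`, `d_ℓ = 1/2`, and `d = 1/2`;
* `C_ℓ`: `d_i = 1` for `i < ℓ`, `d_ℓ = 2`, and `d = 1`;
* `F₄`: `d_1 = d_2 = 1`, `d_3 = d_4 = 1/2`, and `d = 1/2`;
* `G₂`: `d_1 = 1`, `d_2 = 3`, and `d = 1`. -/
def relLen : (g : NSLType) → Fin g.rank → ℕ
  | .B l _, i => if i.val + 1 = l then 1 else 2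
  | .C l _, i => if i.val + 1 = l then 2 else 1
  | .F4, i => if i.val + 1 ≤ 2 then 2 else 1
  | .G2, i => if i.val + 1 = 2 then 3 else 1

/-- The index group `dℤ / d'mℤ`, identified with `ℤ / (d'/d)mℤ` by dividing by `d`. In types
`B_ℓ` and `F₄` a shift by `1/2` becomes a shift by `1`, and a shift by `1` a shift by `2`;
in types `C_ℓ` and `G₂` shifts are unchanged. -/
abbrev Idx (g : NSLType) (m : ℕ) : Type := ZMod (ratio g * m)

/-- The rational function field `𝒴_m = ℂ(y_i(n); i ∈ I, n ∈ dℤ/d'mℤ)`. -/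
abbrev YField (g : NSLType) (m : ℕ) : Type :=
  FractionRing (MvPolynomial (Fin g.rank × Idx g m) ℂ)

/-- The variable `y_i(n)`. -/
def y (g : NSLType) (m : ℕ) (i : Fin g.rank) (n : Idx g m) : YField g m :=
  algebraMap (MvPolynomial (Fin g.rank × Idx g m) ℂ) (YField g m) (MvPolynomial.X (i, n))

/-- `y_k(n)` for a label `k`, with the convention `y_k(n) = 1` if `k ∉ {1, …, ℓ}`. -/
def yLab (g : NSLType) (m : ℕ) (k : ℕ) (n : Idx g m) : YField g m :=
  if h : 1 ≤ k ∧ k ≤ g.rank then y g m ⟨k - 1, by omega⟩ n else 1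

/-- The generic formula `∏_{j < i, C_ij ≠ 0} y_j(n + d_j) · ∏_{j > i, C_ij ≠ 0} y_j(n)`. -/
def FGen (g : NSLType) (m : ℕ) (i : Fin g.rank) (n : Idx g m) : YField g m :=
  (∏ j : Fin g.rank with j < i ∧ cartan g i j ≠ 0, y g m j (n + (relLen g j : Idx g m))) *
    ∏ j : Fin g.rank with i < j ∧ cartan g i j ≠ 0, y g m j n

/-- The elements `F_i(n)`. -/
def F : (g : NSLType) → (m : ℕ) → (i : Fin g.rank) → (n : Idx g m) → YField g m
  | .B l hl, m, i, n =>
    if i.val + 1 = l then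
      yLab (.B l hl) m (l - 1) (n + 1) * yLab (.B l hl) m (l + 1) n
    else if i.val + 1 = l - 1 then
      yLab (.B l hl) m (l - 2) (n + 2) * yLab (.B l hl) m l n * yLab (.B l hl) m l (n + 1)
    else FGen (.B l hl) m i n
  | .C l hl, m, i, n =>
    if i.val + 1 = l then
      yLab (.C l hl) m (l - 1) (n + 1) * yLab (.C l hl) m (l - 1) (n + 2)
    else FGen (.C l hl) m i n
  | .F4, m, i, n =>
    if i.val + 1 = 3 then
      yLab .F4 m 2 (n + 1) * yLab .F4 m 4 n
    else if i.val + 1 = 2 then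
      yLab .F4 m 1 (n + 2) * yLab .F4 m 3 n * yLab .F4 m 3 (n + 1)
    else FGen .F4 m i n
  | .G2, m, i, n =>
    if i.val + 1 = 2 then
      yLab .G2 m 1 (n + 1) * yLab .G2 m 1 (n + 2) * yLab .G2 m 1 (n + 3)
    else FGen .G2 m i n

/-- `X_i(n) = F_i(n) / (y_i(n) y_i(n + d_i))`. -/
def X (g : NSLType) (m : ℕ) (i : Fin g.rank) (n : Idx g m) : YField g m :=
  F g m i n / (y g m i n * y g m i (n + (relLen g i : Idx g m)))

/-- `P_i(n) = 1 + ∑_{k=0}^{d'm/d_i - 2} X_i(n) X_i(n - d_i) ⋯ X_i(n - d_i k)`. -/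
def P (g : NSLType) (m : ℕ) (i : Fin g.rank) (n : Idx g m) : YField g m :=
  1 + ∑ k ∈ Finset.range (ratio g * m / relLen g i - 1),
    ∏ p ∈ Finset.range (k + 1), X g m i (n - (relLen g i : Idx g m) * (p : Idx g m))

/-- The automorphism `r` of `𝒴_m` over `ℂ` is the action of the simple reflection `r_i`:
`r(y_i(n)) = P_i(n - 2 d_i) / P_i(n - d_i) · y_i(n) X_i(n - d_i)`, and `r(y_j(n)) = y_j(n)`
for `j ≠ i`. -/
def IsReflection (g : NSLType) (m : ℕ) (i : Fin g.rank)
    (r : YField g m ≃ₐ[ℂ] YField g m) : Prop :=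
  (∀ n : Idx g m, r (y g m i n) =
    P g m i (n - 2 * (relLen g i : Idx g m)) / P g m i (n - (relLen g i : Idx g m)) *
      y g m i n * X g m i (n - (relLen g i : Idx g m))) ∧
  ∀ (j : Fin g.rank) (n : Idx g m), j ≠ i → r (y g m j n) = y g m j n

/-- The invariant subfield of an automorphism `r` of `𝒴_m`. -/
def invariantField (g : NSLType) (m : ℕ) (r : YField g m ≃ₐ[ℂ] YField g m) :
    IntermediateField ℂ (YField g m) :=
  IntermediateField.fixedField (Subgroup.zpowers r)

/-- `z_i(n) = y_i(n) + F_i(n) / y_i(n + d_i)`. -/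
def z (g : NSLType) (m : ℕ) (i : Fin g.rank) (n : Idx g m) : YField g m :=
  y g m i n + F g m i n / y g m i (n + (relLen g i : Idx g m))

/-- `𝒵_m^{(i)} = ℂ(z_i(n), y_j(n); j ∈ I ∖ {i}, n ∈ dℤ/d'mℤ)`. -/
def ZField (g : NSLType) (m : ℕ) (i : Fin g.rank) : IntermediateField ℂ (YField g m) :=
  IntermediateField.adjoin ℂ
    ({w | ∃ n, w = z g m i n} ∪ {w | ∃ (j : Fin g.rank) (n : Idx g m), j ≠ i ∧ w = y g m j n})

/-- `N_{i,s} = (d_i ℤ + (s - 1) d) / d'mℤ`, a subset of `dℤ/d'mℤ`. -/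
def N (g : NSLType) (m : ℕ) (i : Fin g.rank) (s : ℤ) : Set (Idx g m) :=
  {n | ∃ k : ℤ, n = (((relLen g i : ℤ) * k + (s - 1) : ℤ) : Idx g m)}

/-- The product of the `y_i(n)` over `n ∈ N_{i,s}`. -/
def bigY (g : NSLType) (m : ℕ) (i : Fin g.rank) (s : ℤ) : YField g m :=
  ∏ᶠ n ∈ N g m i s, y g m i n

/-- The product of the `F_i(n)` over `n ∈ N_{i,s}`. -/
def bigF (g : NSLType) (m : ℕ) (i : Fin g.rank) (s : ℤ) : YField g m :=
  ∏ᶠ n ∈ N g m i s, F g m i n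

/-- `δ_{i,s}`: the product of the `y_i(n)` minus the product of the `F_i(n)` divided by the
product of the `y_i(n)`, all over `n ∈ N_{i,s}`. -/
def delta (g : NSLType) (m : ℕ) (i : Fin g.rank) (s : ℤ) : YField g m :=
  bigY g m i s - bigF g m i s / bigY g m i s

/-- `𝒵_m^{(i)′}`: the field `𝒵_m^{(i)}` if `d_i = d`, `𝒵_m^{(i)}(δ_{i,1} δ_{i,2})` if `d_i = 2d`,
and `𝒵_m^{(i)}(δ_{i,1} δ_{i,2}, δ_{i,2} δ_{i,3})` if `d_i = 3d`. -/
def ZPrime (g : NSLType) (m : ℕ) (i : Fin g.rank) : IntermediateField ℂ (YField g m) :=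
  if relLen g i = 1 then ZField g m i
  else if relLen g i = 2 then
    (IntermediateField.adjoin (ZField g m i)
      {delta g m i 1 * delta g m i 2}).restrictScalars ℂ
  else
    (IntermediateField.adjoin (ZField g m i)
      {delta g m i 1 * delta g m i 2, delta g m i 2 * delta g m i 3}).restrictScalars ℂ

end WeylInv

end

/-! On one orbit of the translation by `d_i`, write `Y` for the product of the `y_i` and `F` for the
product of the `F_i`. The equation `z_i(n) = y_i(n) + F_i(n)/y_i(n + d_i)` makes `y_i(n)` a Möbius
transform of `y_i(n + d_i)`. Composing over a full period gives a matrix over `𝒵_m^{(i)}` with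
eigenvector `(y_i(n), 1)`, eigenvalue `Y` and determinant `F` (`exists_monodromy_orbitProd`). Hence
`Y + F/Y`, its trace, lies in `𝒵_m^{(i)}`, and `c y_i(n) + d = Y` with `c`, `d` in `𝒵_m^{(i)}`.

The proposed images of the `y_i(n)` solve the same recursion with the same `z_i(n)`
(`reflVal_add_F_div`), and their orbit product is `F/Y` (`orbitProd_reflVal`). So each `y_i(n)` is
algebraic over the field generated by the images; counting transcendence degree makes the images
independent, and the substitution is an endomorphism. It fixes `𝒵_m^{(i)}` and swaps `Y` with `F/Y`,
so it is an involution.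

It negates every `δ_{i,s}`, while `δ_{i,s}²` lies in `𝒵_m^{(i)}`. Products of two `δ`'s are
therefore invariant, and once these are adjoined `𝒴_m` is spanned by `1` and `δ_{i,1}`
(`exists_add_mul_delta`). An invariant element has no `δ_{i,1}` component. -/

namespace WeylInv

universe u

/-! ### Cyclic recursions -/

section Cyclic

open Finset

/-- The matrix with rows `(z, -f)` and `(1, 0)` sends `(u (k+1), 1)` to `u (k+1)` times `(u k, 1)`.
The matrix `(a, b; c, d)` is the product of the first `k` of these, so its determinant is the
product of the `f j`. -/
theorem exists_monodromy {K S : Type*} [Field K] [SetLike S K] [SubfieldClass S K] (L : S)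
    (u f : ℕ → K) (hf : ∀ k, f k ∈ L) (hz : ∀ k, u k + f k / u (k + 1) ∈ L)
    (hu : ∀ k, u k ≠ 0) (k : ℕ) :
    ∃ a ∈ L, ∃ b ∈ L, ∃ c ∈ L, ∃ d ∈ L, a * d - b * c = ∏ j ∈ range k, f j ∧
      a * u k + b = (∏ j ∈ range k, u (j + 1)) * u 0 ∧
      c * u k + d = ∏ j ∈ range k, u (j + 1) := by
  induction k with
  | zero => exact ⟨1, one_mem L, 0, zero_mem L, 0, zero_mem L, 1, one_mem L, by simp⟩
  | succ k ih =>
    obtain ⟨a, ha, b, hb, c, hc, d, hd, h1, h2, h3⟩ := ih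
    refine ⟨a * (u k + f k / u (k + 1)) + b, add_mem (mul_mem ha (hz k)) hb,
      -(a * f k), neg_mem (mul_mem ha (hf k)),
      c * (u k + f k / u (k + 1)) + d, add_mem (mul_mem hc (hz k)) hd,
      -(c * f k), neg_mem (mul_mem hc (hf k)), ?_, ?_, ?_⟩
    · rw [prod_range_succ, ← h1]; ring
    · have := hu (k + 1)
      rw [prod_range_succ, mul_right_comm, ← h2]; field_simp; ring
    · have := hu (k + 1)
      rw [prod_range_succ, ← h3]; field_simp; ring

/-- The product of `h` along `N` steps of length `e` starting at `n`. -/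
def orbitProd {G K : Type*} [AddCommGroup G] [CommMonoid K] (e : G) (N : ℕ) (h : G → K)
    (n : G) : K :=
  ∏ k ∈ range N, h (n + k • e)

variable {G K : Type*} [AddCommGroup G]

theorem orbitProd_add_step [CommMonoid K] {e : G} {N : ℕ} (hN : N • e = 0)
    (h : G → K) (n : G) : orbitProd e N h (n + e) = orbitProd e N h n := by
  cases N with
  | zero => simp [orbitProd]
  | succ N =>
    unfold orbitProd
    rw [prod_range_succ, prod_range_succ']
    have h1 : n + e + N • e = n := by rw [add_assoc, ← succ_nsmul', hN, add_zero]
    rw [h1]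
    simp only [zero_nsmul, add_zero]
    congr 1
    exact prod_congr rfl fun k _ => by rw [succ_nsmul', add_assoc]

theorem orbitProd_sub_step [CommMonoid K] {e : G} {N : ℕ} (hN : N • e = 0)
    (h : G → K) (n : G) : orbitProd e N h (n - e) = orbitProd e N h n := by
  simpa using (orbitProd_add_step hN h (n - e)).symm

theorem orbitProd_comp_sub [CommMonoid K] (e a : G) (N : ℕ) (h : G → K) (n : G) :
    orbitProd e N (fun k => h (k - a)) n = orbitProd e N h (n - a) :=
  prod_congr rfl fun k _ => by abel_nf

theorem orbitProd_mul [CommMonoid K] (e : G) (N : ℕ) (h h' : G → K) (n : G) :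
    orbitProd e N (fun k => h k * h' k) n = orbitProd e N h n * orbitProd e N h' n :=
  prod_mul_distrib

theorem orbitProd_div [Field K] (e : G) (N : ℕ) (h h' : G → K) (n : G) :
    orbitProd e N (fun k => h k / h' k) n = orbitProd e N h n / orbitProd e N h' n :=
  prod_div_distrib ..

theorem orbitProd_ne_zero [Field K] (e : G) (N : ℕ) {h : G → K} (hh : ∀ n, h n ≠ 0) (n : G) :
    orbitProd e N h n ≠ 0 :=
  prod_ne_zero_iff.2 fun _ _ => hh _

theorem map_orbitProd {F K' : Type*} [CommMonoid K] [CommMonoid K'] [FunLike F K K']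
    [MonoidHomClass F K K'] (φ : F) (e : G) (N : ℕ) (h : G → K) (n : G) :
    φ (orbitProd e N h n) = orbitProd e N (fun k => φ (h k)) n :=
  map_prod φ _ _

/-- The matrix of a full period: `y n` is a fixed point of a Möbius transformation over `L`. -/
theorem exists_monodromy_orbitProd {S : Type*} [Field K] [SetLike S K] [SubfieldClass S K]
    (L : S) {e : G} {N : ℕ} (hN : N • e = 0) (y f : G → K) (hf : ∀ n, f n ∈ L)
    (hz : ∀ n, y n + f n / y (n + e) ∈ L) (hy : ∀ n, y n ≠ 0) (n : G) :
    ∃ a ∈ L, ∃ b ∈ L, ∃ c ∈ L, ∃ d ∈ L, a * d - b * c = orbitProd e N f n ∧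
      a * y n + b = orbitProd e N y n * y n ∧ c * y n + d = orbitProd e N y n := by
  have key := exists_monodromy L (fun k => y (n + k • e)) (fun k => f (n + k • e))
    (fun k => hf _) (fun k => by simpa [succ_nsmul, add_assoc] using hz (n + k • e))
    (fun k => hy _) N
  have h1 : ∏ j ∈ range N, y (n + (j + 1) • e) = orbitProd e N y n := by
    rw [← orbitProd_add_step hN]
    exact prod_congr rfl fun k _ => by rw [succ_nsmul', add_assoc]
  simp only [h1, hN, zero_nsmul, add_zero] at key
  exact key

/-- Since `(u, 1)` is an eigenvector with eigenvalue `Y` and the determinant is `F`, the other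
eigenvalue is `F / Y`. -/
theorem trace_monodromy [Field K] {a b c d u Y F : K} (hY : Y ≠ 0) (h1 : a * d - b * c = F)
    (h2 : a * u + b = Y * u) (h3 : c * u + d = Y) : a + d = Y + F / Y := by
  field_simp
  linear_combination (Y - a) * h3 + c * h2 + h1

/-- Multiplying the shifted sum by `X n` lengthens each of its products by one factor, so all terms
cancel except the initial `1` and the longest product. -/
theorem continuant_sub_mul [CommRing K] (X : G → K) (e n : G) (t : ℕ) :
    (1 + ∑ k ∈ range t, ∏ p ∈ range (k + 1), X (n - p • e)) -
      X n * (1 + ∑ k ∈ range t, ∏ p ∈ range (k + 1), X (n - e - p • e)) =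
      1 - orbitProd (-e) (t + 1) X n := by
  have h (k : ℕ) : X n * ∏ p ∈ range (k + 1), X (n - e - p • e) =
      ∏ p ∈ range (k + 2), X (n - p • e) := by
    rw [prod_range_succ' _ (k + 1), mul_comm]
    simp only [zero_nsmul, sub_zero]
    congr 1
    exact prod_congr rfl fun p _ => by rw [succ_nsmul', sub_sub]
  have h' : orbitProd (-e) (t + 1) X n = ∏ p ∈ range (t + 1), X (n - p • e) :=
    prod_congr rfl fun p _ => by rw [smul_neg, sub_eq_add_neg]
  rw [mul_add, mul_sum, sum_congr rfl fun k _ => h k, h', mul_one]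
  have := sum_range_succ' (fun k => ∏ p ∈ range (k + 1), X (n - p • e)) t
  rw [sum_range_succ] at this
  simp only [zero_add, prod_range_one, zero_nsmul, sub_zero] at this
  linear_combination this

end Cyclic

/-! ### Values of rational functions at a point -/

section EvalsTo

open MvPolynomial

variable {σ : Type*} (v : σ → ℂ)

/-- The rational function `w` is defined at the point `v` and has the value `c` there. -/
def EvalsTo (w : FractionRing (MvPolynomial σ ℂ)) (c : ℂ) : Prop :=
  ∃ p q : MvPolynomial σ ℂ, eval v q ≠ 0 ∧
    w * algebraMap _ _ q = algebraMap _ _ p ∧ eval v p = c * eval v q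

variable {v} {w w' : FractionRing (MvPolynomial σ ℂ)} {c c' : ℂ}

theorem EvalsTo.algebraMap (p : MvPolynomial σ ℂ) :
    EvalsTo v (algebraMap (MvPolynomial σ ℂ) (FractionRing (MvPolynomial σ ℂ)) p) (eval v p) :=
  ⟨p, 1, by simp, by simp, by simp⟩

theorem EvalsTo.one : EvalsTo v 1 1 := by
  simpa using EvalsTo.algebraMap (v := v) 1

theorem EvalsTo.zero : EvalsTo v 0 0 := by
  simpa using EvalsTo.algebraMap (v := v) 0

/-- The purpose of `EvalsTo`: a rational function is nonzero as soon as it has a nonzero value at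
one point. -/
theorem EvalsTo.ne_zero (h : EvalsTo v w c) (hc : c ≠ 0) : w ≠ 0 := by
  rintro rfl
  obtain ⟨p, q, hq, h1, h2⟩ := h
  rw [zero_mul, eq_comm, map_eq_zero_iff _ (IsFractionRing.injective _ _)] at h1
  rw [h1, map_zero] at h2
  exact mul_ne_zero hc hq h2.symm

theorem EvalsTo.mul (h : EvalsTo v w c) (h' : EvalsTo v w' c') : EvalsTo v (w * w') (c * c') := by
  obtain ⟨p, q, hq, h1, h2⟩ := h
  obtain ⟨p', q', hq', h1', h2'⟩ := h'
  refine ⟨p * p', q * q', by simp [hq, hq'], ?_, ?_⟩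
  · rw [map_mul, map_mul, ← h1, ← h1']; ring
  · rw [map_mul, map_mul, h2, h2']; ring

theorem EvalsTo.add (h : EvalsTo v w c) (h' : EvalsTo v w' c') : EvalsTo v (w + w') (c + c') := by
  obtain ⟨p, q, hq, h1, h2⟩ := h
  obtain ⟨p', q', hq', h1', h2'⟩ := h'
  refine ⟨p * q' + p' * q, q * q', by simp [hq, hq'], ?_, ?_⟩
  · rw [map_add, map_mul, map_mul, map_mul, ← h1, ← h1']; ring
  · rw [map_add, map_mul, map_mul, map_mul, h2, h2']; ring

theorem EvalsTo.neg (h : EvalsTo v w c) : EvalsTo v (-w) (-c) := by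
  simpa using (EvalsTo.algebraMap (v := v) (-1)).mul h

theorem EvalsTo.sub (h : EvalsTo v w c) (h' : EvalsTo v w' c') : EvalsTo v (w - w') (c - c') := by
  simpa only [sub_eq_add_neg] using h.add h'.neg

theorem EvalsTo.inv (h : EvalsTo v w c) (hc : c ≠ 0) : EvalsTo v w⁻¹ c⁻¹ := by
  have hw := h.ne_zero hc
  obtain ⟨p, q, hq, h1, h2⟩ := h
  refine ⟨q, p, by rw [h2]; exact mul_ne_zero hc hq, ?_, ?_⟩
  · rw [← h1, inv_mul_cancel_left₀ hw]
  · rw [h2, inv_mul_cancel_left₀ hc]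

theorem EvalsTo.div (h : EvalsTo v w c) (h' : EvalsTo v w' c') (hc : c' ≠ 0) :
    EvalsTo v (w / w') (c / c') := by
  simpa only [div_eq_mul_inv] using h.mul (h'.inv hc)

theorem EvalsTo.prod {κ : Type*} (s : Finset κ) {f : κ → FractionRing (MvPolynomial σ ℂ)}
    {a : κ → ℂ} (h : ∀ k ∈ s, EvalsTo v (f k) (a k)) :
    EvalsTo v (∏ k ∈ s, f k) (∏ k ∈ s, a k) := by
  classical
  induction s using Finset.induction_on with
  | empty => simpa using EvalsTo.one
  | insert k s hk ih =>
    rw [Finset.prod_insert hk, Finset.prod_insert hk]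
    exact (h k (by simp)).mul (ih fun j hj => h j (by simp [hj]))

theorem EvalsTo.sum {κ : Type*} (s : Finset κ) {f : κ → FractionRing (MvPolynomial σ ℂ)}
    {a : κ → ℂ} (h : ∀ k ∈ s, EvalsTo v (f k) (a k)) :
    EvalsTo v (∑ k ∈ s, f k) (∑ k ∈ s, a k) := by
  classical
  induction s using Finset.induction_on with
  | empty => simpa using EvalsTo.zero
  | insert k s hk ih =>
    rw [Finset.sum_insert hk, Finset.sum_insert hk]
    exact (h k (by simp)).add (ih fun j hj => h j (by simp [hj]))

end EvalsTo

/-! ### Rational function fields -/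

section RationalFunctions

variable {σ k : Type u} [Field k]

theorem adjoin_range_algebraMap_X :
    IntermediateField.adjoin k (Set.range fun s : σ =>
      algebraMap (MvPolynomial σ k) (FractionRing (MvPolynomial σ k)) (MvPolynomial.X s)) = ⊤ := by
  rw [eq_top_iff]
  have h (p : MvPolynomial σ k) : algebraMap _ (FractionRing (MvPolynomial σ k)) p ∈
      IntermediateField.adjoin k (Set.range fun s : σ =>
        algebraMap (MvPolynomial σ k) (FractionRing (MvPolynomial σ k)) (MvPolynomial.X s)) := by
    induction p using MvPolynomial.induction_on with
    | C a =>
      rw [← MvPolynomial.algebraMap_eq, ← IsScalarTower.algebraMap_apply]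
      exact IntermediateField.algebraMap_mem _ a
    | add p q hp hq => rw [map_add]; exact add_mem hp hq
    | mul_X p s hp =>
      rw [map_mul]
      exact mul_mem hp (IntermediateField.subset_adjoin _ _ ⟨s, rfl⟩)
  rintro w -
  obtain ⟨p, q, -, rfl⟩ := IsFractionRing.div_surjective (A := MvPolynomial σ k) w
  exact div_mem (h p) (h q)

theorem algHom_fractionRing_ext {E : Type*} [Field E] [Algebra k E]
    {φ ψ : FractionRing (MvPolynomial σ k) →ₐ[k] E}
    (h : ∀ s, φ (algebraMap (MvPolynomial σ k) _ (MvPolynomial.X s)) = ψ (algebraMap (MvPolynomial σ k) _ (MvPolynomial.X s))) : φ = ψ := by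
  ext s
  exact h s

theorem isTranscendenceBasis_algebraMap_X :
    IsTranscendenceBasis k fun s : σ =>
      algebraMap (MvPolynomial σ k) (FractionRing (MvPolynomial σ k)) (MvPolynomial.X s) :=
  have := IsLocalization.isAlgebraic (FractionRing (MvPolynomial σ k))
    (nonZeroDivisors (MvPolynomial σ k))
  (IsTranscendenceBasis.mvPolynomial (R := k) σ).algebraMap_comp

/-- The range of `W` contains a transcendence basis, which has as many elements as `σ`. It must then
be the whole range, with no value of `W` repeated. -/
theorem algebraicIndependent_of_isAlgebraic_adjoin [Finite σ]
    {W : σ → FractionRing (MvPolynomial σ k)}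
    (hW : ∀ s, IsAlgebraic (IntermediateField.adjoin k (Set.range W))
      (algebraMap (MvPolynomial σ k) (FractionRing (MvPolynomial σ k)) (MvPolynomial.X s))) :
    AlgebraicIndependent k W := by
  -- These instances make the generated field the fraction field of the generated algebra, so
  -- algebraicity over either is the same.
  open scoped IntermediateField.algebraAdjoinAdjoin in
  have halg : Algebra.IsAlgebraic (Algebra.adjoin k (Set.range W))
      (FractionRing (MvPolynomial σ k)) := by
    rw [isTranscendenceBasis_algebraMap_X.isAlgebraic_iff]
    intro s
    exact (IsFractionRing.isAlgebraic_iff _ (IntermediateField.adjoin k (Set.range W)) _).2 (hW s)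
  obtain ⟨t, ht, hb⟩ := exists_isTranscendenceBasis_subset (R := k) (Set.range W)
  have hcard : Nat.card t = Nat.card σ := by
    have := hb.cardinalMk_eq_trdeg.trans isTranscendenceBasis_algebraMap_X.cardinalMk_eq_trdeg.symm
    exact congrArg Cardinal.toNat this
  have hfin : (Set.range W).Finite := Set.finite_range W
  have ht' : t = Set.range W := Set.eq_of_subset_of_ncard_le ht
    ((Finite.card_range_le W).trans_eq hcard.symm) hfin
  subst ht'
  have hinj : Function.Injective W := by
    have : Finite (Set.range W) := hfin
    have hb := (Nat.bijective_iff_surjective_and_card (Set.rangeFactorization W)).2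
      ⟨Set.rangeFactorization_surjective, hcard.symm⟩
    exact fun a b h => hb.1 (Subtype.ext h)
  exact (algebraicIndependent_subtype_range hinj).1 hb.1

theorem exists_algHom_of_algebraicIndependent {E : Type*} [Field E] [Algebra k E] {W : σ → E}
    (hW : AlgebraicIndependent k W) : ∃ φ : FractionRing (MvPolynomial σ k) →ₐ[k] E,
      ∀ s, φ (algebraMap (MvPolynomial σ k) _ (MvPolynomial.X s)) = W s := by
  have hinj : Function.Injective (MvPolynomial.aeval (R := k) W) := hW
  exact ⟨IsFractionRing.liftAlgHom (g := MvPolynomial.aeval W) hinj, fun s => by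
    rw [IsFractionRing.liftAlgHom_apply, IsFractionRing.lift_algebraMap]; simp⟩

end RationalFunctions

end WeylInv

namespace WeylInv

variable (g : NSLType) (m : ℕ) (i : Fin g.rank)

/-! ### Orbits of the translation by `d_i` -/

section Orbits

/-- The common length `d'm / d_i` of the orbits of the translation by `d_i`. -/
def period : ℕ := ratio g * m / relLen g i

/-- The translation by `d_i`. -/
abbrev step : Idx g m := (relLen g i : Idx g m)

theorem relLen_pos : 0 < relLen g i := by
  cases g <;> simp only [relLen] <;> split_ifs <;> norm_num

theorem relLen_le_three : relLen g i ≤ 3 := by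
  cases g <;> simp only [relLen] <;> split_ifs <;> norm_num

theorem relLen_dvd_ratio : relLen g i ∣ ratio g := by
  cases g <;> simp only [relLen, ratio] <;> split_ifs <;> norm_num

theorem ratio_pos : 0 < ratio g := by cases g <;> simp [ratio]

theorem relLen_mul_period : relLen g i * period g m i = ratio g * m :=
  Nat.mul_div_cancel' ((relLen_dvd_ratio g i).mul_right m)

theorem period_pos (hm : 0 < m) : 0 < period g m i := by
  have h := relLen_mul_period g m i
  have := Nat.mul_pos (ratio_pos g) hm
  exact Nat.pos_of_ne_zero fun h0 => by rw [h0, mul_zero] at h; omega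

theorem period_nsmul_step : period g m i • step g m i = 0 := by
  rw [nsmul_eq_mul, ← Nat.cast_mul, mul_comm (period g m i)]
  exact (congrArg Nat.cast (relLen_mul_period g m i)).trans (ZMod.natCast_self _)

theorem period_nsmul_neg_step : period g m i • (-step g m i) = 0 := by
  rw [smul_neg, period_nsmul_step, neg_zero]

variable {g m i}

/-- `N_{i,s}` is a single orbit, and `period` steps from any of its points run through it exactly
once. -/
theorem finprod_mem_N {K : Type*} [CommMonoid K] (hm : 0 < m) {s : ℤ} {n : Idx g m}
    (hn : n ∈ N g m i s) (h : Idx g m → K) :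
    ∏ᶠ k ∈ N g m i s, h k = orbitProd (step g m i) (period g m i) h n := by
  have hp := period_pos g m i hm
  have hset : N g m i s =
      (fun k : ℕ => n + k • step g m i) '' (Finset.range (period g m i) : Finset ℕ) := by
    obtain ⟨k₀, rfl⟩ := hn
    ext x
    constructor
    · rintro ⟨k, rfl⟩
      have h0 : (0 : ℤ) < period g m i := by exact_mod_cast hp
      have h1 := Int.emod_nonneg (k - k₀) h0.ne'
      have h2 := Int.emod_lt_of_pos (k - k₀) h0
      refine ⟨((k - k₀) % (period g m i : ℤ)).toNat, ?_, ?_⟩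
      · simp only [Finset.coe_range, Set.mem_Iio]; omega
      · have h3 := Int.emod_add_mul_ediv (k - k₀) (period g m i)
        have h4 : ((((k - k₀) % (period g m i : ℤ)).toNat : ℕ) : Idx g m) =
            (((k - k₀) % (period g m i : ℤ) : ℤ) : Idx g m) := by
          rw [← Int.cast_natCast, Int.toNat_of_nonneg h1]
        have h5 := period_nsmul_step g m i
        have h6 := congrArg (Int.cast : ℤ → Idx g m) h3
        simp only [nsmul_eq_mul] at h5 ⊢
        rw [h4]
        push_cast at h6 ⊢
        linear_combination (relLen g i : Idx g m) * h6 -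
          (((k - k₀) / (period g m i : ℤ) : ℤ) : Idx g m) * h5
    · rintro ⟨k, -, rfl⟩
      exact ⟨k₀ + k, by simp only [nsmul_eq_mul]; push_cast; ring⟩
  have hinj : Set.InjOn (fun k : ℕ => n + k • step g m i)
      (Finset.range (period g m i) : Finset ℕ) := by
    intro a ha b hb hab
    simp only [Finset.coe_range, Set.mem_Iio] at ha hb
    have h1 := add_left_cancel hab
    simp only [nsmul_eq_mul, ← Nat.cast_mul] at h1
    rw [ZMod.natCast_eq_natCast_iff', ← relLen_mul_period g m i, mul_comm a, mul_comm b,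
      Nat.mod_eq_of_lt (Nat.mul_lt_mul_of_pos_left ha (relLen_pos g i)),
      Nat.mod_eq_of_lt (Nat.mul_lt_mul_of_pos_left hb (relLen_pos g i))] at h1
    exact Nat.eq_of_mul_eq_mul_left (relLen_pos g i) h1
  rw [hset, finprod_mem_image hinj, finprod_mem_coe_finset]
  rfl

theorem exists_mem_N (hm : 0 < m) (n : Idx g m) :
    ∃ s : ℤ, 1 ≤ s ∧ s ≤ relLen g i ∧ n ∈ N g m i s := by
  have : NeZero (ratio g * m) := ⟨(Nat.mul_pos (ratio_pos g) hm).ne'⟩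
  have h1 := Nat.mod_lt n.val (relLen_pos g i)
  -- The residue of `n` modulo `d_i/d` is `s - 1`.
  refine ⟨(n.val % relLen g i : ℕ) + 1, by omega, by omega, (n.val / relLen g i : ℕ), ?_⟩
  have h2 := congrArg (Nat.cast : ℕ → Idx g m) (Nat.div_add_mod n.val (relLen g i))
  rw [ZMod.natCast_zmod_val] at h2
  refine h2.symm.trans ?_
  generalize n.val % relLen g i = a
  generalize n.val / relLen g i = b
  push_cast
  ring

theorem natCast_mem_N (s : ℤ) : ((s - 1 : ℤ) : Idx g m) ∈ N g m i s := ⟨0, by simp⟩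

end Orbits

/-! ### The elements `F_i(n)`, `X_i(n)`, `P_i(n)` -/

section Elements

variable {g m i}

theorem y_ne_zero (j : Fin g.rank) (n : Idx g m) : y g m j n ≠ 0 := by
  unfold y
  rw [Ne, map_eq_zero_iff _ (IsFractionRing.injective _ _)]
  exact MvPolynomial.X_ne_zero _

/-- The submonoid of monomials in the variables `y_j(n)`, `j ≠ i`. -/
noncomputable def monomialsOff (g : NSLType) (m : ℕ) (i : Fin g.rank) : Submonoid (YField g m) :=
  Submonoid.closure {w | ∃ (j : Fin g.rank) (n : Idx g m), j ≠ i ∧ w = y g m j n}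

theorem y_mem_monomialsOff {j : Fin g.rank} (h : j ≠ i) (n : Idx g m) :
    y g m j n ∈ monomialsOff g m i :=
  Submonoid.subset_closure ⟨j, n, h, rfl⟩

theorem yLab_mem_monomialsOff {k : ℕ} (h : k ≠ i.val + 1) (n : Idx g m) :
    yLab g m k n ∈ monomialsOff g m i := by
  unfold yLab
  split_ifs with hk
  · exact y_mem_monomialsOff (fun h' => h (by rw [← h']; simp only; omega)) n
  · exact one_mem _

theorem FGen_mem_monomialsOff (n : Idx g m) : FGen g m i n ∈ monomialsOff g m i := by
  refine mul_mem (prod_mem fun j hj => ?_) (prod_mem fun j hj => ?_)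
  · exact y_mem_monomialsOff (Finset.mem_filter.1 hj).2.1.ne _
  · exact y_mem_monomialsOff (Finset.mem_filter.1 hj).2.1.ne' _

/-- The explicit formulas for `F_i(n)` matter only here: later arguments need only that it is a
monomial in the `y_j` with `j ≠ i`. -/
theorem F_mem_monomialsOff (n : Idx g m) : F g m i n ∈ monomialsOff g m i := by
  cases g with
  | B l hl =>
    simp only [F]
    split_ifs
    · exact mul_mem (yLab_mem_monomialsOff (by omega) _) (yLab_mem_monomialsOff (by omega) _)
    · exact mul_mem (mul_mem (yLab_mem_monomialsOff (by omega) _)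
        (yLab_mem_monomialsOff (by omega) _)) (yLab_mem_monomialsOff (by omega) _)
    · exact FGen_mem_monomialsOff n
  | C l hl =>
    simp only [F]
    split_ifs
    · exact mul_mem (yLab_mem_monomialsOff (by omega) _) (yLab_mem_monomialsOff (by omega) _)
    · exact FGen_mem_monomialsOff n
  | F4 =>
    simp only [F]
    split_ifs
    · exact mul_mem (yLab_mem_monomialsOff (by omega) _) (yLab_mem_monomialsOff (by omega) _)
    · exact mul_mem (mul_mem (yLab_mem_monomialsOff (by omega) _)
        (yLab_mem_monomialsOff (by omega) _)) (yLab_mem_monomialsOff (by omega) _)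
    · exact FGen_mem_monomialsOff n
  | G2 =>
    simp only [F]
    split_ifs
    · exact mul_mem (mul_mem (yLab_mem_monomialsOff (by omega) _)
        (yLab_mem_monomialsOff (by omega) _)) (yLab_mem_monomialsOff (by omega) _)
    · exact FGen_mem_monomialsOff n

theorem monomialsOff_le {S : Submonoid (YField g m)}
    (h : ∀ (j : Fin g.rank) (n : Idx g m), j ≠ i → y g m j n ∈ S) : monomialsOff g m i ≤ S := by
  refine Submonoid.closure_le.2 ?_
  rintro _ ⟨j, n, hj, rfl⟩
  exact h j n hj

theorem F_mem_of_forall {S : Type*} [SetLike S (YField g m)] [SubmonoidClass S (YField g m)]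
    {L : S} (h : ∀ (j : Fin g.rank) (n : Idx g m), j ≠ i → y g m j n ∈ L) (n : Idx g m) :
    F g m i n ∈ L :=
  monomialsOff_le (S := Submonoid.ofClass L) h (F_mem_monomialsOff n)

theorem F_ne_zero (n : Idx g m) : F g m i n ≠ 0 :=
  mem_nonZeroDivisors_iff_ne_zero.1 <| F_mem_of_forall (L := nonZeroDivisors (YField g m))
    (fun j n _ => mem_nonZeroDivisors_iff_ne_zero.2 (y_ne_zero j n)) n

theorem map_F {φ : YField g m →ₐ[ℂ] YField g m}
    (h : ∀ (j : Fin g.rank) (n : Idx g m), j ≠ i → φ (y g m j n) = y g m j n) (n : Idx g m) :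
    φ (F g m i n) = F g m i n :=
  F_mem_of_forall (L := MonoidHom.eqLocusM (φ : YField g m →* YField g m) (MonoidHom.id _)) h n

/-- The point with `y_i(n) = 2` and `y_j(n) = 1` for `j ≠ i`. -/
noncomputable def testPoint (g : NSLType) (m : ℕ) (i : Fin g.rank) : Fin g.rank × Idx g m → ℂ :=
  fun p => if p.1 = i then 2 else 1

theorem evalsTo_y (n : Idx g m) : EvalsTo (testPoint g m i) (y g m i n) 2 := by
  simpa [testPoint, y] using
    EvalsTo.algebraMap (v := testPoint g m i) (MvPolynomial.X (i, n))

theorem evalsTo_y_off {j : Fin g.rank} (h : j ≠ i) (n : Idx g m) :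
    EvalsTo (testPoint g m i) (y g m j n) 1 := by
  simpa [testPoint, y, h] using
    EvalsTo.algebraMap (v := testPoint g m i) (MvPolynomial.X (j, n))

theorem evalsTo_F (n : Idx g m) : EvalsTo (testPoint g m i) (F g m i n) 1 := by
  let S : Submonoid (YField g m) :=
    { carrier := {w | EvalsTo (testPoint g m i) w 1}
      one_mem' := EvalsTo.one
      mul_mem' := fun {a b} ha hb => by simpa using EvalsTo.mul ha hb }
  exact F_mem_of_forall (L := S) (fun j n hj => evalsTo_y_off hj n) n

theorem evalsTo_X (n : Idx g m) : EvalsTo (testPoint g m i) (X g m i n) (1 / (2 * 2)) :=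
  (evalsTo_F n).div ((evalsTo_y n).mul (evalsTo_y _)) (by norm_num)

theorem P_ne_zero (n : Idx g m) : P g m i n ≠ 0 := by
  have h : EvalsTo (testPoint g m i) (P g m i n)
      (1 + ∑ k ∈ Finset.range (ratio g * m / relLen g i - 1),
        ∏ _p ∈ Finset.range (k + 1), (1 / (2 * 2) : ℂ)) :=
    EvalsTo.one.add (EvalsTo.sum _ fun k _ => EvalsTo.prod _ fun p _ => evalsTo_X _)
  refine h.ne_zero ?_
  -- Each `X_i` has value `1/4` at the test point, so `P_i` takes a positive real value.
  have h1 : (0 : ℝ) < 1 + ∑ k ∈ Finset.range (ratio g * m / relLen g i - 1),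
        ∏ _p ∈ Finset.range (k + 1), (1 / (2 * 2) : ℝ) := by positivity
  have h2 := Complex.ofReal_ne_zero.2 h1.ne'
  push_cast at h2
  exact h2

/-- The product of the `y_i` over the orbit of `n`. -/
noncomputable def orbY (g : NSLType) (m : ℕ) (i : Fin g.rank) : Idx g m → YField g m :=
  orbitProd (step g m i) (period g m i) (y g m i)

/-- The product of the `F_i` over the orbit of `n`. -/
noncomputable def orbF (g : NSLType) (m : ℕ) (i : Fin g.rank) : Idx g m → YField g m :=
  orbitProd (step g m i) (period g m i) (F g m i)

theorem orbY_ne_zero (n : Idx g m) : orbY g m i n ≠ 0 := orbitProd_ne_zero _ _ (y_ne_zero i) n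

theorem orbF_ne_zero (n : Idx g m) : orbF g m i n ≠ 0 := orbitProd_ne_zero _ _ F_ne_zero n

/-- At the test point the two sides are `4 ^ period` and `1`. This keeps the two eigenvalues `Y` and
`F/Y` distinct. -/
theorem orbY_sq_ne_orbF (hm : 0 < m) (n : Idx g m) : orbY g m i n ^ 2 ≠ orbF g m i n := by
  have h : EvalsTo (testPoint g m i) (orbY g m i n)
      (∏ _p ∈ Finset.range (period g m i), (2 : ℂ)) := by
    unfold orbY orbitProd
    exact EvalsTo.prod _ fun k _ => evalsTo_y (n + k • step g m i)
  have h' : EvalsTo (testPoint g m i) (orbF g m i n)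
      (∏ _p ∈ Finset.range (period g m i), (1 : ℂ)) := by
    unfold orbF orbitProd
    exact EvalsTo.prod _ fun k _ => evalsTo_F (n + k • step g m i)
  have h2 := (h.mul h).sub h'
  rw [← sub_ne_zero, sq]
  refine h2.ne_zero ?_
  simp only [Finset.prod_const, Finset.card_range, one_pow, ← mul_pow]
  have h3 : (1 : ℝ) < (2 * 2) ^ period g m i :=
    one_lt_pow₀ (by norm_num) (period_pos g m i hm).ne'
  rw [sub_ne_zero]
  exact_mod_cast h3.ne'

theorem delta_eq (hm : 0 < m) {s : ℤ} {n : Idx g m} (hn : n ∈ N g m i s) :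
    delta g m i s = orbY g m i n - orbF g m i n / orbY g m i n := by
  unfold delta bigY bigF
  rw [finprod_mem_N hm hn, finprod_mem_N hm hn]
  rfl

theorem delta_ne_zero (hm : 0 < m) (s : ℤ) : delta g m i s ≠ 0 := by
  rw [delta_eq hm (natCast_mem_N s), sub_ne_zero, Ne, eq_div_iff (orbY_ne_zero _), ← sq]
  exact orbY_sq_ne_orbF hm _

theorem P_sub_X_mul_P (hm : 0 < m) (n : Idx g m) :
    P g m i n - X g m i n * P g m i (n - step g m i) =
      1 - orbitProd (-step g m i) (period g m i) (X g m i) n := by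
  have h := continuant_sub_mul (X g m i) (step g m i) n (period g m i - 1)
  rw [Nat.sub_add_cancel (period_pos g m i hm)] at h
  simpa only [P, nsmul_eq_mul, mul_comm, period] using h

/-- The image of `y_i(n)` under the simple reflection `r_i`. -/
noncomputable def reflVal (g : NSLType) (m : ℕ) (i : Fin g.rank) (n : Idx g m) : YField g m :=
  P g m i (n - 2 * step g m i) / P g m i (n - step g m i) * y g m i n * X g m i (n - step g m i)

theorem X_ne_zero (n : Idx g m) : X g m i n ≠ 0 :=
  div_ne_zero (F_ne_zero _) (mul_ne_zero (y_ne_zero _ _) (y_ne_zero _ _))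

/-- After clearing denominators the claim is that `P(n) - X(n) P(n - d_i)` does not change under `n
↦ n - d_i`. It equals one minus the product of `X` over the whole orbit. -/
theorem reflVal_add_F_div (hm : 0 < m) (n : Idx g m) :
    reflVal g m i n + F g m i n / reflVal g m i (n + step g m i) = z g m i n := by
  have h1 := P_sub_X_mul_P (i := i) hm n
  have h2 := P_sub_X_mul_P (i := i) hm (n - step g m i)
  rw [sub_eq_add_neg n, orbitProd_add_step (period_nsmul_neg_step g m i),
    ← sub_eq_add_neg n] at h2
  have e1 : n + step g m i - 2 * step g m i = n - step g m i := by ring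
  have e2 : n + step g m i - step g m i = n := by ring
  have e3 : n - step g m i - step g m i = n - 2 * step g m i := by ring
  have hX : F g m i n = X g m i n * (y g m i n * y g m i (n + step g m i)) := by
    rw [X, div_mul_cancel₀ _ (mul_ne_zero (y_ne_zero _ _) (y_ne_zero _ _))]
  unfold reflVal z
  rw [e1, e2, hX]
  rw [e3] at h2
  have := P_ne_zero (i := i) n
  have := P_ne_zero (i := i) (n - step g m i)
  have := X_ne_zero (i := i) n
  have := y_ne_zero i (n + step g m i)
  have := y_ne_zero i n
  generalize X g m i n = x at *
  field_simp
  linear_combination h1 - h2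

/-- The ratios of `P`'s cancel around the orbit, leaving the factors `y_i(n) X_i(n - d_i) = F_i(n -
d_i) / y_i(n - d_i)`. -/
theorem orbitProd_reflVal (n : Idx g m) :
    orbitProd (step g m i) (period g m i) (reflVal g m i) n =
      orbF g m i n / orbY g m i n := by
  have hW : reflVal g m i = fun n => P g m i (n - 2 * step g m i) / P g m i (n - step g m i) *
      (F g m i (n - step g m i) / y g m i (n - step g m i)) := by
    funext n
    have := y_ne_zero i n
    have := y_ne_zero i (n - step g m i)
    have := P_ne_zero (i := i) (n - step g m i)
    unfold reflVal X
    rw [sub_add_cancel]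
    field_simp
  have hs := period_nsmul_step g m i
  rw [hW, orbitProd_mul, orbitProd_div, orbitProd_div]
  simp only [orbitProd_comp_sub, orbitProd_sub_step hs]
  rw [two_mul, ← sub_sub, orbitProd_sub_step hs, orbitProd_sub_step hs,
    div_self (orbitProd_ne_zero _ _ P_ne_zero _), one_mul]
  rfl

end Elements

end WeylInv

namespace WeylInv

variable {g : NSLType} {m : ℕ} {i : Fin g.rank}

/-! ### The simple reflection -/

section Reflection

/-- `IsReflection` for algebra endomorphisms. -/
def IsReflectionHom (g : NSLType) (m : ℕ) (i : Fin g.rank)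
    (φ : YField g m →ₐ[ℂ] YField g m) : Prop :=
  (∀ n, φ (y g m i n) = reflVal g m i n) ∧
    ∀ (j : Fin g.rank) (n : Idx g m), j ≠ i → φ (y g m j n) = y g m j n

theorem isReflection_iff {r : YField g m ≃ₐ[ℂ] YField g m} :
    IsReflection g m i r ↔ IsReflectionHom g m i r := Iff.rfl

theorem algHom_ext_y {φ ψ : YField g m →ₐ[ℂ] YField g m}
    (h : ∀ (j : Fin g.rank) (n : Idx g m), φ (y g m j n) = ψ (y g m j n)) : φ = ψ :=
  algHom_fractionRing_ext fun s => h s.1 s.2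

theorem IsReflectionHom.unique {φ ψ : YField g m →ₐ[ℂ] YField g m}
    (hφ : IsReflectionHom g m i φ) (hψ : IsReflectionHom g m i ψ) : φ = ψ := by
  refine algHom_ext_y fun j n => ?_
  by_cases hj : j = i
  · subst hj; rw [hφ.1, hψ.1]
  · rw [hφ.2 j n hj, hψ.2 j n hj]

theorem z_mem_ZField (n : Idx g m) : z g m i n ∈ ZField g m i :=
  IntermediateField.subset_adjoin _ _ (Or.inl ⟨n, rfl⟩)

theorem y_mem_ZField (j : Fin g.rank) (n : Idx g m) (hj : j ≠ i) : y g m j n ∈ ZField g m i :=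
  IntermediateField.subset_adjoin _ _ (Or.inr ⟨j, n, hj, rfl⟩)

theorem orbF_mem {L : IntermediateField ℂ (YField g m)}
    (h : ∀ (j : Fin g.rank) (n : Idx g m), j ≠ i → y g m j n ∈ L) (n : Idx g m) :
    orbF g m i n ∈ L := by
  unfold orbF orbitProd
  exact prod_mem fun _ _ => F_mem_of_forall h _

theorem exists_monodromy_y {L : IntermediateField ℂ (YField g m)}
    (hz : ∀ n, z g m i n ∈ L)
    (h : ∀ (j : Fin g.rank) (n : Idx g m), j ≠ i → y g m j n ∈ L) (n : Idx g m) :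
    ∃ a ∈ L, ∃ b ∈ L, ∃ c ∈ L, ∃ d ∈ L, a * d - b * c = orbF g m i n ∧
      a * y g m i n + b = orbY g m i n * y g m i n ∧ c * y g m i n + d = orbY g m i n :=
  exists_monodromy_orbitProd L (period_nsmul_step g m i) (y g m i) (F g m i)
    (F_mem_of_forall h) hz (y_ne_zero i) n

/-- As a fixed point of the monodromy, `y_i(n)` is a root of `c T² + (d - a) T - b`. If this
polynomial vanished, the matrix would be the scalar `Y`, with determinant `Y² = F`. The field `L` is
left general because the lemma is applied to the field generated by the proposed images. -/
theorem isAlgebraic_y (hm : 0 < m) {L : IntermediateField ℂ (YField g m)}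
    (hz : ∀ n, z g m i n ∈ L)
    (h : ∀ (j : Fin g.rank) (n : Idx g m), j ≠ i → y g m j n ∈ L) (n : Idx g m) :
    IsAlgebraic L (y g m i n) := by
  obtain ⟨a, ha, b, hb, c, hc, d, hd, h1, h2, h3⟩ := exists_monodromy_y hz h n
  refine ⟨Polynomial.C ⟨c, hc⟩ * Polynomial.X ^ 2 +
    Polynomial.C (⟨d, hd⟩ - ⟨a, ha⟩) * Polynomial.X + Polynomial.C (-⟨b, hb⟩), fun h0 => ?_, ?_⟩
  · have c0 := congrArg (fun p => p.coeff 2) h0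
    have c1 := congrArg (fun p => p.coeff 1) h0
    have c2 := congrArg (fun p => p.coeff 0) h0
    simp [Polynomial.coeff_X, Polynomial.coeff_C, sub_eq_zero] at c0 c1 c2
    have c0 := congrArg Subtype.val c0
    have c2 := congrArg Subtype.val c2
    simp only [ZeroMemClass.coe_zero] at c0 c2
    subst c0 c1 c2
    refine orbY_sq_ne_orbF (i := i) hm n ?_
    rw [← h1, ← h3]; ring
  · simp [IntermediateField.algebraMap_apply]
    linear_combination (y g m i n) * h3 - h2

theorem exists_isReflectionHom (hm : 0 < m) : ∃ φ, IsReflectionHom g m i φ := by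
  classical
  have : NeZero (ratio g * m) := ⟨(Nat.mul_pos (ratio_pos g) hm).ne'⟩
  let W : Fin g.rank × Idx g m → YField g m := fun s =>
    if s.1 = i then reflVal g m i s.2 else y g m s.1 s.2
  have hWi (n) : W (i, n) = reflVal g m i n := if_pos rfl
  have hWj (j n) (hj : j ≠ i) : W (j, n) = y g m j n := if_neg hj
  have hmem (s) : W s ∈ IntermediateField.adjoin ℂ (Set.range W) :=
    IntermediateField.subset_adjoin _ _ ⟨s, rfl⟩
  have hy (j : Fin g.rank) (n : Idx g m) (hj : j ≠ i) :
      y g m j n ∈ IntermediateField.adjoin ℂ (Set.range W) := by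
    rw [← hWj j n hj]; exact hmem _
  -- The images determine the `z_i(n)` by the recursion, so the monodromy matrix is defined over the
  -- field they generate.
  have hz (n) : z g m i n ∈ IntermediateField.adjoin ℂ (Set.range W) := by
    rw [← reflVal_add_F_div hm, ← hWi, ← hWi]
    exact add_mem (hmem _) (div_mem (F_mem_of_forall hy n) (hmem _))
  have hind : AlgebraicIndependent ℂ W := by
    refine algebraicIndependent_of_isAlgebraic_adjoin fun s => ?_
    by_cases hs : s.1 = i
    · obtain ⟨j, n⟩ := s
      obtain rfl : j = i := hs
      exact isAlgebraic_y hm hz hy n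
    · exact isAlgebraic_algebraMap
        (⟨_, hy s.1 s.2 hs⟩ : IntermediateField.adjoin ℂ (Set.range W))
  obtain ⟨φ, hφ⟩ := exists_algHom_of_algebraicIndependent hind
  exact ⟨φ, fun n => (hφ (i, n)).trans (hWi n), fun j n hj => (hφ (j, n)).trans (hWj j n hj)⟩

variable {φ : YField g m →ₐ[ℂ] YField g m}

theorem IsReflectionHom.map_z (hm : 0 < m) (h : IsReflectionHom g m i φ) (n : Idx g m) :
    φ (z g m i n) = z g m i n := by
  conv_rhs => rw [← reflVal_add_F_div hm]
  rw [z, map_add, map_div₀, map_F h.2, h.1, h.1]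

theorem IsReflectionHom.map_orbF (h : IsReflectionHom g m i φ) (n : Idx g m) :
    φ (orbF g m i n) = orbF g m i n := by
  rw [orbF, map_orbitProd]; simp only [map_F h.2]

theorem IsReflectionHom.map_orbY (h : IsReflectionHom g m i φ) (n : Idx g m) :
    φ (orbY g m i n) = orbF g m i n / orbY g m i n := by
  rw [← orbitProd_reflVal, orbY, map_orbitProd]; simp only [h.1]

theorem IsReflectionHom.map_delta (hm : 0 < m) (h : IsReflectionHom g m i φ) (s : ℤ) :
    φ (delta g m i s) = -delta g m i s := by
  rw [delta_eq hm (natCast_mem_N s), map_sub, map_div₀, h.map_orbY, h.map_orbF]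
  have := orbY_ne_zero (i := i) ((s - 1 : ℤ) : Idx g m)
  have := orbF_ne_zero (i := i) ((s - 1 : ℤ) : Idx g m)
  field_simp
  ring

theorem IsReflectionHom.map_ZField (hm : 0 < m) (h : IsReflectionHom g m i φ) {w : YField g m}
    (hw : w ∈ ZField g m i) : φ w = w := by
  unfold ZField at hw
  induction hw using IntermediateField.adjoin_induction with
  | mem x hx =>
    obtain ⟨n, rfl⟩ | ⟨j, n, hj, rfl⟩ := hx
    · exact h.map_z hm n
    · exact h.2 j n hj
  | algebraMap x => exact φ.commutes x
  | add x y _ _ hx hy => rw [map_add, hx, hy]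
  | inv x _ hx => rw [map_inv₀, hx]
  | mul x y _ _ hx hy => rw [map_mul, hx, hy]

/-- `y_i(n)` is a rational function of the orbit product over `𝒵_m^{(i)}`. -/
theorem IsReflectionHom.exists_mul_y_add (hm : 0 < m) (h : IsReflectionHom g m i φ)
    (n : Idx g m) : ∃ c ∈ ZField g m i, ∃ d ∈ ZField g m i,
      c ≠ 0 ∧ c * y g m i n + d = orbY g m i n := by
  obtain ⟨a, ha, b, hb, c, hc, d, hd, -, -, h3⟩ :=
    exists_monodromy_y (g := g) (m := m) (i := i) z_mem_ZField y_mem_ZField n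
  refine ⟨c, hc, d, hd, ?_, h3⟩
  -- If `c = 0`, then `Y = d` lies in `𝒵_m^{(i)}` and is fixed by `φ`, which forces `Y = F / Y`.
  rintro rfl
  rw [zero_mul, zero_add] at h3
  have := h.map_ZField hm hd
  rw [h3, h.map_orbY, div_eq_iff (orbY_ne_zero n), ← sq] at this
  exact orbY_sq_ne_orbF hm n this.symm

/-- Applying `φ` twice to `c y_i(n) + d = Y` fixes `c`, `d` and `Y`, hence `y_i(n)`. -/
theorem IsReflectionHom.comp_self (hm : 0 < m) (h : IsReflectionHom g m i φ) :
    φ.comp φ = AlgHom.id ℂ _ := by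
  refine algHom_ext_y fun j n => ?_
  by_cases hj : j = i
  · subst hj
    obtain ⟨c, hc, d, hd, hc0, hcd⟩ := h.exists_mul_y_add hm n
    have h2 := congrArg (fun w => φ (φ w)) hcd
    simp only [map_add, map_mul, h.map_ZField hm hc, h.map_ZField hm hd, h.map_orbY, map_div₀,
      h.map_orbF] at h2
    rw [div_div_cancel₀ (orbF_ne_zero n), ← hcd] at h2
    exact mul_left_cancel₀ hc0 (add_right_cancel h2)
  · simp [h.2 j n hj]

theorem existsUnique_isReflection (hm : 0 < m) (i : Fin g.rank) :
    ∃! r : YField g m ≃ₐ[ℂ] YField g m, IsReflection g m i r := by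
  obtain ⟨φ, hφ⟩ := exists_isReflectionHom (g := g) (i := i) hm
  refine ⟨AlgEquiv.ofAlgHom φ φ (hφ.comp_self hm) (hφ.comp_self hm), hφ, fun r hr => ?_⟩
  have := (isReflection_iff.1 hr).unique hφ
  exact AlgEquiv.ext fun w => DFunLike.congr_fun this w

end Reflection

/-! ### The invariant field -/

section InvariantField

theorem orbY_add_mem_ZField (n : Idx g m) :
    orbY g m i n + orbF g m i n / orbY g m i n ∈ ZField g m i := by
  obtain ⟨a, ha, b, hb, c, hc, d, hd, h1, h2, h3⟩ :=
    exists_monodromy_y (g := g) (m := m) (i := i) z_mem_ZField y_mem_ZField n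
  rw [← trace_monodromy (orbY_ne_zero n) h1 h2 h3]
  exact add_mem ha hd

/-- The square is the discriminant `(Y + F/Y)² - 4F` of the monodromy matrix. -/
theorem delta_sq_mem_ZField (hm : 0 < m) (s : ℤ) : delta g m i s ^ 2 ∈ ZField g m i := by
  rw [delta_eq hm (natCast_mem_N s)]
  have h : (orbY g m i ((s - 1 : ℤ) : Idx g m) - orbF g m i ((s - 1 : ℤ) : Idx g m) /
      orbY g m i ((s - 1 : ℤ) : Idx g m)) ^ 2 =
      (orbY g m i ((s - 1 : ℤ) : Idx g m) + orbF g m i ((s - 1 : ℤ) : Idx g m) /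
      orbY g m i ((s - 1 : ℤ) : Idx g m)) ^ 2 - 4 * orbF g m i ((s - 1 : ℤ) : Idx g m) := by
    have := orbY_ne_zero (i := i) ((s - 1 : ℤ) : Idx g m)
    field_simp
    ring
  rw [h]
  exact sub_mem (pow_mem (orbY_add_mem_ZField _) 2)
    (mul_mem (ofNat_mem _ 4) (orbF_mem y_mem_ZField _))

theorem ZField_le_ZPrime : ZField g m i ≤ ZPrime g m i := by
  unfold ZPrime
  split_ifs
  · exact le_rfl
  · exact fun w hw => IntermediateField.algebraMap_mem (IntermediateField.adjoin (ZField g m i) _)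
      (⟨w, hw⟩ : ZField g m i)
  · exact fun w hw => IntermediateField.algebraMap_mem (IntermediateField.adjoin (ZField g m i) _)
      (⟨w, hw⟩ : ZField g m i)

theorem delta_mul_mem_ZPrime (hm : 0 < m) {s : ℤ} (h1 : 1 ≤ s) (h2 : s ≤ relLen g i) :
    delta g m i 1 * delta g m i s ∈ ZPrime g m i := by
  obtain rfl | h1 := h1.eq_or_lt
  · rw [← sq]; exact ZField_le_ZPrime (delta_sq_mem_ZField hm 1)
  have h3 := relLen_le_three g i
  have hZ {w : YField g m} {S : Set (YField g m)} (hw : w ∈ ZField g m i) :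
      w ∈ IntermediateField.adjoin (ZField g m i) S :=
    IntermediateField.algebraMap_mem _ (⟨w, hw⟩ : ZField g m i)
  unfold ZPrime
  rw [if_neg (by omega)]
  split_ifs with h4
  · obtain rfl : s = 2 := by omega
    rw [IntermediateField.mem_restrictScalars]
    exact IntermediateField.subset_adjoin _ _ (Set.mem_singleton _)
  · have m12 : delta g m i 1 * delta g m i 2 ∈ IntermediateField.adjoin (ZField g m i)
        {delta g m i 1 * delta g m i 2, delta g m i 2 * delta g m i 3} :=
      IntermediateField.subset_adjoin _ _ (Or.inl rfl)
    have m23 : delta g m i 2 * delta g m i 3 ∈ IntermediateField.adjoin (ZField g m i)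
        {delta g m i 1 * delta g m i 2, delta g m i 2 * delta g m i 3} :=
      IntermediateField.subset_adjoin _ _ (Or.inr rfl)
    rw [IntermediateField.mem_restrictScalars]
    obtain rfl | rfl : s = 2 ∨ s = 3 := by omega
    · exact m12
    -- The missing product is recovered from the two generators, because `δ_{i,2}²` is already in
    -- `𝒵_m^{(i)}`.
    · have h5 : delta g m i 1 * delta g m i 3 = (delta g m i 1 * delta g m i 2) *
          (delta g m i 2 * delta g m i 3) / delta g m i 2 ^ 2 := by
        have := delta_ne_zero (i := i) hm 2
        field_simp
      rw [h5]
      exact div_mem (mul_mem m12 m23) (hZ (delta_sq_mem_ZField hm 2))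

variable {φ : YField g m →ₐ[ℂ] YField g m}

theorem IsReflectionHom.map_adjoin (hm : 0 < m) (h : IsReflectionHom g m i φ)
    {S : Set (YField g m)} (hS : ∀ x ∈ S, φ x = x) {w : YField g m}
    (hw : w ∈ IntermediateField.adjoin (ZField g m i) S) : φ w = w := by
  induction hw using IntermediateField.adjoin_induction with
  | mem x hx => exact hS x hx
  | algebraMap x => exact h.map_ZField hm x.2
  | add x y _ _ hx hy => rw [map_add, hx, hy]
  | inv x _ hx => rw [map_inv₀, hx]
  | mul x y _ _ hx hy => rw [map_mul, hx, hy]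

theorem IsReflectionHom.map_ZPrime (hm : 0 < m) (h : IsReflectionHom g m i φ) {w : YField g m}
    (hw : w ∈ ZPrime g m i) : φ w = w := by
  have hd (s t : ℤ) : φ (delta g m i s * delta g m i t) = delta g m i s * delta g m i t := by
    rw [map_mul, h.map_delta hm, h.map_delta hm, neg_mul_neg]
  unfold ZPrime at hw
  split_ifs at hw
  · exact h.map_ZField hm hw
  · refine h.map_adjoin hm ?_ hw
    rintro x rfl
    exact hd 1 2
  · refine h.map_adjoin hm ?_ hw
    rintro x (rfl | rfl)
    exacts [hd 1 2, hd 2 3]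

/-- `𝒴_m` is spanned by `1` and `δ_{i,1}` over `𝒵_m^{(i)′}`. -/
theorem IsReflectionHom.exists_add_mul_delta (hm : 0 < m) (h : IsReflectionHom g m i φ)
    (w : YField g m) :
    ∃ a ∈ ZPrime g m i, ∃ b ∈ ZPrime g m i, w = a + b * delta g m i 1 := by
  have hsq : delta g m i 1 ^ 2 ∈ ZPrime g m i := ZField_le_ZPrime (delta_sq_mem_ZField hm 1)
  have hw : w ∈ IntermediateField.adjoin ℂ (Set.range fun s : Fin g.rank × Idx g m =>
      algebraMap (MvPolynomial (Fin g.rank × Idx g m) ℂ) (YField g m) (MvPolynomial.X s)) := by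
    rw [adjoin_range_algebraMap_X]; trivial
  induction hw using IntermediateField.adjoin_induction with
  | mem x hx =>
    obtain ⟨⟨j, n⟩, rfl⟩ := hx
    change ∃ a ∈ ZPrime g m i, ∃ b ∈ ZPrime g m i, y g m j n = _
    by_cases hj : j = i
    · subst hj
      obtain ⟨c, hc, d, hd, hc0, hcd⟩ := h.exists_mul_y_add hm n
      obtain ⟨s, hs1, hs2, hs⟩ := exists_mem_N (i := j) hm n
      have ht := orbY_add_mem_ZField (i := j) n
      have hδ := delta_eq hm hs
      have hc' := ZField_le_ZPrime hc
      have two : (2 : YField g m) ∈ ZPrime g m j := ofNat_mem _ 2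
      -- With `t = Y + F/Y`, the coefficients come from `y_i(n) = (Y - d)/c`, `Y = (t + δ_{i,s})/2`
      -- and `δ_{i,s} = (δ_{i,1} δ_{i,s} / δ_{i,1}²) δ_{i,1}`.
      refine ⟨_, div_mem (sub_mem (div_mem (ZField_le_ZPrime ht) two) (ZField_le_ZPrime hd)) hc',
        _, div_mem (div_mem (div_mem (delta_mul_mem_ZPrime hm hs1 hs2) hsq) two) hc', ?_⟩
      have := delta_ne_zero (i := j) hm 1
      have hY := orbY_ne_zero (i := j) n
      rw [← mul_right_inj' hc0, ← add_left_inj d, hcd, hδ]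
      field_simp
      ring
    · exact ⟨_, ZField_le_ZPrime (y_mem_ZField j n hj), 0, zero_mem _, by simp⟩
  | algebraMap x => exact ⟨_, IntermediateField.algebraMap_mem _ x, 0, zero_mem _, by simp⟩
  | add x y _ _ hx hy =>
    obtain ⟨a, ha, b, hb, rfl⟩ := hx
    obtain ⟨a', ha', b', hb', rfl⟩ := hy
    exact ⟨_, add_mem ha ha', _, add_mem hb hb', by ring⟩
  | mul x y _ _ hx hy =>
    obtain ⟨a, ha, b, hb, rfl⟩ := hx
    obtain ⟨a', ha', b', hb', rfl⟩ := hy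
    exact ⟨_, add_mem (mul_mem ha ha') (mul_mem (mul_mem hb hb') hsq), _,
      add_mem (mul_mem ha hb') (mul_mem hb ha'), by ring⟩
  | inv x _ hx =>
    obtain ⟨a, ha, b, hb, rfl⟩ := hx
    by_cases h0 : a + b * delta g m i 1 = 0
    · exact ⟨0, zero_mem _, 0, zero_mem _, by simp [h0]⟩
    -- The conjugate is the image of a nonzero element under `φ`, so the inverse can be
    -- rationalized.
    have h1 : a - b * delta g m i 1 ≠ 0 := by
      have := (map_ne_zero φ).2 h0
      rwa [map_add, map_mul, h.map_ZPrime hm ha, h.map_ZPrime hm hb, h.map_delta hm, mul_neg,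
        ← sub_eq_add_neg] at this
    have hD : a ^ 2 - b ^ 2 * delta g m i 1 ^ 2 ∈ ZPrime g m i :=
      sub_mem (pow_mem ha 2) (mul_mem (pow_mem hb 2) hsq)
    have hDe : a ^ 2 - b ^ 2 * delta g m i 1 ^ 2 =
      (a + b * delta g m i 1) * (a - b * delta g m i 1) := by ring
    refine ⟨_, div_mem ha hD, _, div_mem (neg_mem hb) hD, ?_⟩
    rw [hDe]
    field_simp
    ring

theorem IsReflectionHom.map_eq_iff (hm : 0 < m) (h : IsReflectionHom g m i φ) {w : YField g m} :
    φ w = w ↔ w ∈ ZPrime g m i := by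
  refine ⟨fun hw => ?_, h.map_ZPrime hm⟩
  obtain ⟨a, ha, b, hb, rfl⟩ := h.exists_add_mul_delta hm w
  rw [map_add, map_mul, h.map_ZPrime hm ha, h.map_ZPrime hm hb, h.map_delta hm] at hw
  have : b * delta g m i 1 = 0 := by linear_combination (-1 / 2 : YField g m) * hw
  rwa [this, add_zero]

theorem invariantField_eq_ZPrime (hm : 0 < m) {r : YField g m ≃ₐ[ℂ] YField g m}
    (hr : IsReflection g m i r) : invariantField g m r = ZPrime g m i := by
  ext w
  rw [← (isReflection_iff.1 hr).map_eq_iff hm]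
  unfold invariantField
  rw [IntermediateField.mem_fixedField_iff]
  refine ⟨fun h => h r (Subgroup.mem_zpowers r), fun h f hf => ?_⟩
  -- Being fixed by the generator `r` suffices, since stabilizers are subgroups.
  have hle : Subgroup.zpowers r ≤ MulAction.stabilizer _ w := by
    rw [Subgroup.zpowers_le]; exact h
  exact hle hf

end InvariantField

end WeylInv

theorem mainTheorem2 (g : WeylInv.NSLType) (m : ℕ) (hm : 1 < m) (i : Fin g.rank) :
    (∃! r : WeylInv.YField g m ≃ₐ[ℂ] WeylInv.YField g m, WeylInv.IsReflection g m i r) ∧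
    ∀ r : WeylInv.YField g m ≃ₐ[ℂ] WeylInv.YField g m, WeylInv.IsReflection g m i r →
      WeylInv.invariantField g m r = WeylInv.ZPrime g m i :=
  ⟨WeylInv.existsUnique_isReflection (zero_lt_one.trans hm) i,
    fun _ hr => WeylInv.invariantField_eq_ZPrime (zero_lt_one.trans hm) hr⟩
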